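/- Let $F$ be a field of characteristic $2$. For $a\in F$ and $b\in F^\times$ let $[a,b)$ be the quaternion $F$-algebra generated by $x,y$ with $x^2+x=a$, $y^2=b$, $yxy^{-1}=x+1$; write $[[b]]$ for the binary quadratic form $x^2+xy+by^2$, and for $a_1,\dots,a_n\in F^\times$ put $\langle\langle a_1,\dots,a_n,b]]=\langle 1,a_1\rangle\otimes\cdots\otimes\langle 1,a_n\rangle\otimes[[b]]$. Two quadratic forms are Witt equivalent if their orthogonal sum is hyperbolic, i.e. an orthogonal sum of hyperbolic planes $xy$. Quaternion algebras are *separably linked* if there are $c\in F$ and $b_i\in F^\times$ such that the norm form of the $i$-th algebra is isometric to $\langle 1,b_i\rangle\otimes[[c]]$. For a set $S$ of quaternion algebras let $G$ be the subgroup of the Brauer group of $F$ generated by their classes; $S$ is *tight* if every element of $G$ is the class of a quaternion algebra. If $S$ is tight and $G$ is finite, then $\Sigma_S$ is the Witt class of the orthogonal sum of the norm forms of quaternion algebras representing the elements of $G$, one for each element. Let $\alpha\in F$ and $\beta,\gamma\in F^\times$ with $\beta\neq\alpha^2$, and put $$\psi=[\alpha^2+\beta,\gamma),\qquad \phi=[\beta+\alpha^4\beta^{-1},\beta+\alpha^2).$$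 Then: 1. $\psi$ and $\phi$ are separably linked; moreover, if $F$ has a separable quadratic field extension at all, then some separable quadratic field extension of $F$ embeds over $F$ in both $\psi$ and $\phi$. 2. The set $\{\psi,\phi\}$ is tight. In particular $\psi\otimes_F\phi$ is Brauer equivalent to a quaternion algebra, and for every quaternion algebra $\xi$ Brauer equivalent to $\psi\otimes_F\phi$, the orthogonal sum of the norm forms of $\psi$, $\phi$ and $\xi$ is Witt equivalent to $\langle\langle\gamma,\beta,\alpha]]$. 3. If the subgroup $G$ generated by the classes of $\psi$ and $\phi$ in the Brauer group of $F$ does not have order exactly $2$, then $G$ is finite and $\Sigma_{\{\psi,\phi\}}$ (for any choice of the representatives) is the Witt class of $\langle\langle\gamma,\beta,\alpha]]$. -/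

import Mathlib

open scoped Quaternion TensorProduct

universe u

/-! ### Quadratic forms -/

/-- The binary quadratic form `[a, b]`, i.e. `(x, y) ↦ a x² + x y + b y²`. -/
noncomputable def binaryForm {F : Type*} [Field F] (a b : F) : QuadraticForm F (F × F) :=
  a • QuadraticMap.linMulLin (LinearMap.fst F F F) (LinearMap.fst F F F)
    + QuadraticMap.linMulLin (LinearMap.fst F F F) (LinearMap.snd F F F)
    + b • QuadraticMap.linMulLin (LinearMap.snd F F F) (LinearMap.snd F F F)

theorem binaryForm_apply {F : Type*} [Field F] (a b : F) (v : F × F) :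
    binaryForm a b v = a * v.1 ^ 2 + v.1 * v.2 + b * v.2 ^ 2 := by
  simp [binaryForm, sq]

/-- A quadratic form is hyperbolic if it is isometric to an orthogonal sum of finitely many
hyperbolic planes `[0, 0]`. -/
def IsHyperbolic {F V : Type*} [Field F] [AddCommGroup V] [Module F V]
    (q : QuadraticForm F V) : Prop :=
  ∃ n : ℕ, QuadraticMap.Equivalent q (QuadraticMap.pi fun _ : Fin n => binaryForm (0 : F) 0)

/-- Two quadratic forms are Witt equivalent if their orthogonal sum is hyperbolic
(characteristic 2; this forces both forms to be nonsingular and finite-dimensional). -/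
def WittEquivalent {F V W : Type*} [Field F] [AddCommGroup V] [Module F V]
    [AddCommGroup W] [Module F W] (q : QuadraticForm F V) (q' : QuadraticForm F W) : Prop :=
  IsHyperbolic (q.prod q')

/-- The tensor product `⟨c i⟩_{i ∈ ι} ⊗ q` of a diagonal bilinear form and a quadratic form `q`
on `V`. The space `F^ι ⊗ V` is identified with `ι → V` by `w ⊗ v ↦ (i ↦ w i • v)`. -/
noncomputable def diagTensor {F V ι : Type*} [Field F] [AddCommGroup V] [Module F V] [Fintype ι]
    (c : ι → F) (q : QuadraticForm F V) : QuadraticForm F (ι → V) :=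
  QuadraticMap.pi fun i => c i • q

/-- The defining rule `(B ⊗ q) (w ⊗ v) = B (w, w) * q v` for `B = ⟨c i⟩`. -/
theorem diagTensor_tmul {F V ι : Type*} [Field F] [AddCommGroup V] [Module F V] [Fintype ι]
    (c : ι → F) (q : QuadraticForm F V) (w : ι → F) (v : V) :
    diagTensor c q (fun i => w i • v) = (∑ i, c i * w i * w i) * q v := by
  simp only [diagTensor, QuadraticMap.pi_apply, smul_apply, QuadraticMap.map_smul,
    smul_eq_mul, Finset.sum_mul]
  exact Finset.sum_congr rfl fun i _ => by ring

/-- The quadratic `(n+1)`-fold Pfister form `⟨⟨a 0, …, a (n-1), b]] = ⟨⟨a 0, …, a (n-1)⟩⟩ ⊗ [1, b]`.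
The bilinear form `⟨1, a 0⟩ ⊗ ⋯ ⊗ ⟨1, a (n-1)⟩` is the diagonal form with the entries
`∏ i ∈ I, a i`, where `I` runs over the subsets of `{0, …, n-1}`. -/
noncomputable def quadPfister {F : Type*} [Field F] {n : ℕ} (a : Fin n → Fˣ) (b : F) :
    QuadraticForm F (Finset (Fin n) → F × F) :=
  diagTensor (fun I => ∏ i ∈ I, (a i : F)) (binaryForm 1 b)

/-- A family of quadratic `(n+2)`-fold Pfister forms `q i` is separably linked if there are a
quadratic `(n+1)`-fold Pfister form `π` and bilinear 1-fold Pfister forms `⟨1, b i⟩` such that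
`q i` is isometric to `⟨1, b i⟩ ⊗ π` for all `i`. -/
def SeparablyLinked {F ι : Type*} [Field F] {V : ι → Type*} [∀ i, AddCommGroup (V i)]
    [∀ i, Module F (V i)] (n : ℕ) (q : ∀ i, QuadraticForm F (V i)) : Prop :=
  ∃ (a : Fin n → Fˣ) (c : F) (b : ι → Fˣ),
    ∀ i, QuadraticMap.Equivalent (q i) (diagTensor ![1, (b i : F)] (quadPfister a c))

/-! ### Quaternion algebras in characteristic 2 -/

/-- The quaternion algebra `[a, b)`. In terms of the standard generators `x = i`, `y = j` the
relations are `x² = a + x`, `y² = b` and `y x = (1 - x) y`; in characteristic 2 these are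
`x² + x = a`, `y² = b`, `y x y⁻¹ = x + 1`. -/
abbrev Quat {F : Type*} [Field F] (a : F) (b : Fˣ) : Type _ := ℍ[F, a, 1, (b : F)]

/-- The norm form `z ↦ z * star z` of `[a, b)`, where `star` is the canonical involution
(`star x = 1 - x`, `star y = -y`); `z * star z` is a scalar. -/
noncomputable def normForm {F : Type*} [Field F] (a : F) (b : Fˣ) :
    QuadraticForm F (Quat a b) :=
  LinearMap.BilinMap.toQuadraticMap <|
    LinearMap.mk₂ F (fun z w : Quat a b => (z * star w).re)
      (fun z z' w => by rw [add_mul, QuaternionAlgebra.re_add])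
      (fun c z w => by rw [smul_mul_assoc, QuaternionAlgebra.re_smul])
      (fun z w w' => by rw [star_add, mul_add, QuaternionAlgebra.re_add])
      (fun c z w => by rw [QuaternionAlgebra.star_smul, mul_smul_comm, QuaternionAlgebra.re_smul])

theorem coe_normForm {F : Type*} [Field F] (a : F) (b : Fˣ) (z : Quat a b) :
    ((normForm a b z : F) : Quat a b) = z * star z :=
  (QuaternionAlgebra.mul_star_eq_coe z).symm

theorem quat_isCentral {F : Type*} [Field F] [CharP F 2] (a : F) (b : Fˣ) :
    Algebra.IsCentral F (Quat a b) := by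
  refine ⟨fun z hz => ?_⟩
  rw [Subalgebra.mem_center_iff] at hz
  have h2 : (2 : F) = 0 := CharTwo.two_eq_zero
  have hi := hz ⟨0, 1, 0, 0⟩
  have hj := hz ⟨0, 0, 1, 0⟩
  obtain ⟨p, q, r, s⟩ := z
  simp only [QuaternionAlgebra.mk_mul_mk, QuaternionAlgebra.mk.injEq] at hi hj
  obtain ⟨-, -, h3, h4⟩ := hi
  obtain ⟨j1, j2, j3, j4⟩ := hj
  have hr : r = 0 := by linear_combination (a * s) * h2 - h3
  have hs : s = 0 := by linear_combination h4 - r * h2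
  have hq : q = 0 := by linear_combination j3
  subst hr hs hq
  exact ⟨p, rfl⟩

theorem quat_isSimple {F : Type*} [Field F] [CharP F 2] (a : F) (b : Fˣ) :
    IsSimpleRing (Quat a b) := by
  have hb : (b : F) ≠ 0 := b.ne_zero
  have h2 : (2 : F) = 0 := CharTwo.two_eq_zero
  refine .of_eq_bot_or_eq_top fun I => ?_
  rw [or_iff_not_imp_left, ← I.one_mem_iff]
  intro hI
  obtain ⟨z, hz, hz0 : z ≠ 0⟩ := SetLike.exists_of_lt (bot_lt_iff_ne_bot.mpr hI : ⊥ < I)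
  -- a nonzero scalar in the ideal
  have key0 : ∀ r : F, r ≠ 0 → (⟨r, 0, 0, 0⟩ : Quat a b) ∈ I → (1 : Quat a b) ∈ I := by
    intro r hr h
    have := I.mul_mem_left ⟨r⁻¹, 0, 0, 0⟩ _ h
    rw [QuaternionAlgebra.mk_mul_mk] at this
    convert this using 1
    ext <;> simp [hr]
  -- a nonzero element of `F[x]` in the ideal
  have key1 : ∀ r s : F, ¬ (r = 0 ∧ s = 0) → (⟨r, s, 0, 0⟩ : Quat a b) ∈ I →
      (1 : Quat a b) ∈ I := by
    intro r s hrs h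
    by_cases hs : s = 0
    · exact key0 r (fun hr => hrs ⟨hr, hs⟩) (hs ▸ h)
    · have h' := I.mul_mem_right _ ⟨0, 0, (b : F)⁻¹, 0⟩ (I.mul_mem_left ⟨0, 0, 1, 0⟩ _ h)
      refine key0 s hs ?_
      have h3 := I.sub_mem h' h
      convert h3 using 1
      ext <;> simp <;> field_simp <;>
        first | ring1 | linear_combination s * h2
  obtain ⟨p, q, r, s⟩ := z
  have hc : (⟨0, 0, r, s⟩ : Quat a b) ∈ I := by
    have h3 := I.sub_mem (I.mul_mem_right _ ⟨0, 1, 0, 0⟩ hz) (I.mul_mem_left ⟨0, 1, 0, 0⟩ _ hz)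
    convert h3 using 1
    ext <;> simp
    · linear_combination (a * s) * h2
    · linear_combination (r + s) * h2
  by_cases hrs : r = 0 ∧ s = 0
  · obtain ⟨rfl, rfl⟩ := hrs
    refine key1 p q ?_ hz
    rintro ⟨rfl, rfl⟩
    exact hz0 rfl
  · refine key1 r s hrs ?_
    have h3 := I.mul_mem_right _ ⟨0, 0, (b : F)⁻¹, 0⟩ hc
    convert h3 using 1
    ext <;> simp <;> field_simp

/-- A family of quaternion algebras is separably linked if the family of their norm forms, which
are quadratic 2-fold Pfister forms, is separably linked. A quaternion algebra `[a, b)` is given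
by the pair `(a, b)`. -/
def QuatSeparablyLinked {F ι : Type*} [Field F] (Q : ι → F × Fˣ) : Prop :=
  SeparablyLinked 0 fun i => normForm (Q i).1 (Q i).2

/-- `K` is a separable quadratic field extension of `F`. -/
def IsSeparableQuadratic (F K : Type*) [Field F] [Field K] [Algebra F K] : Prop :=
  Algebra.IsSeparable F K ∧ Module.finrank F K = 2

/-- A family of quaternion algebras over `F` shares a common separable quadratic field extension
of `F`. -/
def ShareSeparableQuadratic {F : Type u} {ι : Type*} [Field F] (Q : ι → F × Fˣ) : Prop :=
  ∃ (K : Type u) (_ : Field K) (_ : Algebra F K), IsSeparableQuadratic F K ∧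
    ∀ i, Nonempty (K →ₐ[F] Quat (Q i).1 (Q i).2)

/-! ### The Brauer group, tight sets and the invariant `Σ` -/

/-- The class of the quaternion algebra `[a, b)` in the Brauer group. -/
noncomputable def quatClass {F : Type u} [Field F] [CharP F 2] (a : F) (b : Fˣ) :
    BrauerGroup.{u, u} F :=
  haveI := quat_isCentral a b
  haveI := quat_isSimple a b
  haveI : FiniteDimensional F (Quat a b) := inferInstance
  Quotient.mk (Brauer.CSA_Setoid F) (CSA.mk (AlgCat.of F (Quat a b)))

/-- The class of a central simple algebra in the Brauer group. -/
def CSA.brauerClass {F : Type u} [Field F] (A : CSA.{u, u} F) : BrauerGroup.{u, u} F :=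
  Quotient.mk (Brauer.CSA_Setoid F) A

/-- The class `z` is the product of the classes `x` and `y` in the Brauer group. -/
def IsBrauerProduct {F : Type u} [Field F] (x y z : BrauerGroup.{u, u} F) : Prop :=
  ∃ A B C : CSA.{u, u} F, A.brauerClass = x ∧ B.brauerClass = y ∧ C.brauerClass = z ∧
    Nonempty (C ≃ₐ[F] A ⊗[F] B)

/-- The subgroup of the Brauer group generated by `S`: the smallest set of Brauer classes that
contains `S` and the trivial class and is closed under products (tensor products of algebras) and
inverses (opposite algebras). -/
inductive brauerSubgroup {F : Type u} [Field F] (S : Set (BrauerGroup.{u, u} F)) :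
    Set (BrauerGroup.{u, u} F)
  | of_mem {x : BrauerGroup.{u, u} F} (hx : x ∈ S) : brauerSubgroup S x
  | one (A : CSA.{u, u} F) (e : A ≃ₐ[F] F) : brauerSubgroup S A.brauerClass
  | mul {x y z : BrauerGroup.{u, u} F} (hx : brauerSubgroup S x) (hy : brauerSubgroup S y)
      (h : IsBrauerProduct x y z) : brauerSubgroup S z
  | inv (A B : CSA.{u, u} F) (hA : brauerSubgroup S A.brauerClass) (e : B ≃ₐ[F] Aᵐᵒᵖ) :
      brauerSubgroup S B.brauerClass

/-- A set `S` of Brauer classes is tight if every element of the subgroup generated by `S` is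
represented by a quaternion algebra. -/
def IsTight {F : Type u} [Field F] [CharP F 2] (S : Set (BrauerGroup.{u, u} F)) : Prop :=
  ∀ x ∈ brauerSubgroup S, ∃ (a : F) (b : Fˣ), quatClass a b = x

/-- For a set `S` that is tight and generates a finite subgroup `G`, the invariant `Σ_S` is the
Witt class of the orthogonal sum of the norm forms of quaternion algebras representing the elements
of `G`, one for each. `SigmaWittEquivalent S q` says that `Σ_S` is defined and is the Witt class
of `q`, for every enumeration of `G` and every choice of the representatives. -/
def SigmaWittEquivalent {F : Type u} {V : Type*} [Field F] [CharP F 2] [AddCommGroup V]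
    [Module F V] (S : Set (BrauerGroup.{u, u} F)) (q : QuadraticForm F V) : Prop :=
  (brauerSubgroup S).Finite ∧ IsTight S ∧
    ∀ (m : ℕ) (e : Fin m ≃ brauerSubgroup S) (a : Fin m → F) (b : Fin m → Fˣ),
      (∀ i, quatClass (a i) (b i) = (e i : BrauerGroup.{u, u} F)) →
        WittEquivalent (QuadraticMap.pi fun i => normForm (a i) (b i)) q

theorem add_sq_ne_zero {F : Type*} [Field F] [CharP F 2] {α β : F} (h : β ≠ α ^ 2) :
    β + α ^ 2 ≠ 0 := fun h' => h (CharTwo.add_eq_zero.mp h')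

/-!
Put `δ = β + α²`. Then `ψ = [δ, γ)` and `φ = [δ² / β, δ)`, and the second algebra is isomorphic to
`[δ, β)` (`Quat.nonempty_algEquiv_swap`). So both algebras contain the étale algebra `F[x]` with
`x² + x = δ`, which gives the separable linkage. If it is not a field, both algebras are split and
contain every quadratic extension (`exists_isSeparableQuadratic_algHom`).

The map `b ↦ [δ, b)` is multiplicative on Brauer classes: `[δ, b) ⊗ [δ, b')` is the algebra of
`2 × 2` matrices over `[δ, b b')` (`Quat.nonempty_tensor_algEquiv`). It kills squares, so the subgroup
generated by the two classes consists of the classes of `[δ, 1)`, `[δ, γ)`, `[δ, β)` and `[δ, γ β)`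
(`brauerSubgroup_pair_eq`), which proves tightness.

By the uniqueness part of the Artin–Wedderburn theorem (`nonempty_algEquiv_of_matrix`), a quaternion
algebra is determined by its Brauer class, and an isomorphism of quaternion algebras preserves the
norm form (`normForm_equivalent_of_algEquiv`). Hence the representatives may be taken to be the
algebras `[δ, b)`, with norm form `[1, δ] ⊥ b [1, δ]`. As `[1, δ] ⊥ [1, δ]` is hyperbolic, the norm
forms for `b = γ, β, γ β` add up to `[1, δ] ⊥ γ [1, δ] ⊥ β [1, δ] ⊥ γ β [1, δ]`. Finally `[δ, β)` is
isomorphic to `[α, β)` by the substitution `x ↦ x + y + α`, so this sum is `⟨⟨γ, β, α]]`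
(`wittEquivalent_normForm_sum`).

For the invariant of the pair, the four classes form a quotient of an elementary abelian group of
order 4. If its order is not 2, the classes are either distinct or all trivial
(`quatClass_injective_or_eq_one`); in the second case the Pfister form is hyperbolic as well.
-/

/-! ### Isometries and hyperbolic forms -/

section QuadraticForms

open QuadraticMap

variable {F : Type*} [Field F] {V V₁ V₂ V₃ V₄ : Type*}
  [AddCommGroup V] [Module F V] [AddCommGroup V₁] [Module F V₁] [AddCommGroup V₂] [Module F V₂]
  [AddCommGroup V₃] [Module F V₃] [AddCommGroup V₄] [Module F V₄]

theorem QuadraticMap.Equivalent.smul {q : QuadraticForm F V₁} {q' : QuadraticForm F V₂}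
    (h : q.Equivalent q') (c : F) : (c • q).Equivalent (c • q') := by
  obtain ⟨e⟩ := h
  exact ⟨{ e.toLinearEquiv with map_app' := fun m => by simp }⟩

theorem QuadraticMap.Equivalent.piCongrLeft {ι κ : Type*} [Fintype ι] [Fintype κ] {W : κ → Type*}
    [∀ k, AddCommGroup (W k)] [∀ k, Module F (W k)] (q : ∀ k, QuadraticForm F (W k)) (σ : ι ≃ κ) :
    (QuadraticMap.pi fun i => q (σ i)).Equivalent (QuadraticMap.pi q) :=
  ⟨{ LinearEquiv.piCongrLeft F W σ with
    map_app' := fun m => by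
      simp only [QuadraticMap.pi_apply]
      refine (Fintype.sum_equiv σ _ _ fun i => ?_).symm
      exact congrArg _ (Equiv.piCongrLeft_apply_apply W σ m i).symm }⟩

theorem QuadraticMap.Equivalent.prod_pi_pi {ι κ : Type*} [Fintype ι] [Fintype κ]
    (q : QuadraticForm F V) :
    ((QuadraticMap.pi fun _ : ι => q).prod (QuadraticMap.pi fun _ : κ => q)).Equivalent
      (QuadraticMap.pi fun _ : ι ⊕ κ => q) :=
  ⟨{ (LinearEquiv.sumArrowLequivProdArrow ι κ F V).symm with
    map_app' := fun m => by
      simp [QuadraticMap.pi_apply, LinearEquiv.sumArrowLequivProdArrow,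
        Equiv.sumArrowEquivProdArrow] }⟩

theorem IsHyperbolic.of_equivalent {q : QuadraticForm F V₁} {q' : QuadraticForm F V₂}
    (h : IsHyperbolic q') (e : q.Equivalent q') : IsHyperbolic q :=
  let ⟨n, hn⟩ := h
  ⟨n, e.trans hn⟩

theorem isHyperbolic_of_pi {ι : Type*} [Fintype ι] {q : QuadraticForm F V}
    (h : q.Equivalent (QuadraticMap.pi fun _ : ι => binaryForm (0 : F) 0)) : IsHyperbolic q :=
  ⟨Fintype.card ι, h.trans
    (QuadraticMap.Equivalent.piCongrLeft (fun _ => binaryForm (0 : F) 0) (Fintype.equivFin ι))⟩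

theorem IsHyperbolic.prod {q : QuadraticForm F V₁} {q' : QuadraticForm F V₂}
    (h : IsHyperbolic q) (h' : IsHyperbolic q') : IsHyperbolic (q.prod q') := by
  obtain ⟨n, hn⟩ := h
  obtain ⟨m, hm⟩ := h'
  exact isHyperbolic_of_pi ((hn.prod hm).trans (.prod_pi_pi _))

theorem IsHyperbolic.smul {q : QuadraticForm F V} (h : IsHyperbolic q) (c : Fˣ) :
    IsHyperbolic ((c : F) • q) := by
  obtain ⟨n, hn⟩ := h
  refine ⟨n, (hn.smul (c : F)).trans ?_⟩
  refine ⟨{ LinearEquiv.piCongrRight fun _ : Fin n =>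
      (LinearEquiv.refl F F).prodCongr (LinearEquiv.smulOfUnit c) with map_app' := fun m => ?_ }⟩
  simp only [smul_apply, QuadraticMap.pi_apply, binaryForm_apply, Finset.smul_sum]
  refine Finset.sum_congr rfl fun i _ => ?_
  have hc : LinearEquiv.smulOfUnit (R := F) c (m i).2 = c * (m i).2 := rfl
  simp [hc]
  ring

theorem IsHyperbolic.pi_unique {ι : Type*} [Fintype ι] [Unique ι] {W : ι → Type*}
    [∀ i, AddCommGroup (W i)] [∀ i, Module F (W i)] {q : ∀ i, QuadraticForm F (W i)}
    (h : IsHyperbolic (q default)) : IsHyperbolic (QuadraticMap.pi q) :=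
  h.of_equivalent ⟨{ LinearEquiv.piUnique F W with
    map_app' := fun m => by simp [QuadraticMap.pi_apply] }⟩

/-- Over a field of characteristic 2, the double of a scaled binary form `c [1, d]` is the sum of
two hyperbolic planes. In the coordinates `u = x + x'`, `v = y + y'` the value is
`u * c (u + y + v) + v * c (x + d v)`. -/
theorem isHyperbolic_smul_binaryForm_prod_self [CharP F 2] (c : Fˣ) (d : F) :
    IsHyperbolic (((c : F) • binaryForm 1 d).prod ((c : F) • binaryForm 1 d)) := by
  have h2 : (2 : F) = 0 := CharTwo.two_eq_zero
  have hc : (c : F) ≠ 0 := c.ne_zero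
  refine ⟨2, ⟨{
    toFun := fun p => ![(p.1.1 + p.2.1, c * (p.1.1 + p.2.1 + p.2.2)),
      (p.1.2 + p.2.2, c * (p.1.1 + d * (p.1.2 + p.2.2)))]
    invFun := fun f =>
      (((c : F)⁻¹ * (f 1).2 + d * (f 1).1, (c : F)⁻¹ * (f 0).2 + (f 0).1 + (f 1).1),
        ((c : F)⁻¹ * (f 1).2 + d * (f 1).1 + (f 0).1, (c : F)⁻¹ * (f 0).2 + (f 0).1))
    map_add' := fun p p' => ?_
    map_smul' := fun r p => ?_
    left_inv := fun p => ?_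
    right_inv := fun f => ?_
    map_app' := fun p => ?_ }⟩⟩
  · ext i <;> fin_cases i <;> simp <;> ring
  · ext i <;> fin_cases i <;> simp <;> ring
  · ext <;> simp <;> ring_nf <;> simp [h2]
  · ext i <;> fin_cases i <;> simp <;> field_simp <;> ring_nf <;> simp [h2]
  · simp [QuadraticMap.pi_apply, binaryForm_apply]
    linear_combination
      (p.1.1 * p.2.1 * c + p.1.1 * c * p.2.2 + c * p.2.2 * p.1.2 * d) * h2

/-- In the sum of `p ⊥ q`, `p ⊥ r`, `p ⊥ s` and `p ⊥ q ⊥ r ⊥ s` every form occurs an even number of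
times, so the sum is hyperbolic as soon as the doubles of the four forms are. -/
theorem wittEquivalent_sum_three {p q r s : QuadraticForm F V} (hp : IsHyperbolic (p.prod p))
    (hq : IsHyperbolic (q.prod q)) (hr : IsHyperbolic (r.prod r)) (hs : IsHyperbolic (s.prod s)) :
    WittEquivalent (((p.prod q).prod (p.prod r)).prod (p.prod s))
      ((p.prod r).prod (q.prod s)) :=
  ((hp.prod hp).prod (hq.prod (hr.prod hs))).of_equivalent
    ⟨{ toFun := fun x => (((x.1.1.1.1, x.1.1.2.1), (x.1.2.1, x.2.1.1)),
        ((x.1.1.1.2, x.2.2.1), ((x.1.1.2.2, x.2.1.2), (x.1.2.2, x.2.2.2))))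
       invFun := fun y => ((((y.1.1.1, y.2.1.1), (y.1.1.2, y.2.2.1.1)), (y.1.2.1, y.2.2.2.1)),
        ((y.1.2.2, y.2.2.1.2), (y.2.1.2, y.2.2.2.2)))
       map_add' := fun _ _ => rfl
       map_smul' := fun _ _ => rfl
       left_inv := fun _ => rfl
       right_inv := fun _ => rfl
       map_app' := fun x => by simp only [QuadraticMap.prod_apply]; ring }⟩

theorem equivalent_pi_fin_four (q : Fin 4 → QuadraticForm F V) :
    (QuadraticMap.pi q).Equivalent ((q 0).prod (((q 1).prod (q 2)).prod (q 3))) :=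
  ⟨{ toFun := fun f => (f 0, ((f 1, f 2), f 3))
     invFun := fun y => ![y.1, y.2.1.1, y.2.1.2, y.2.2]
     map_add' := fun _ _ => rfl
     map_smul' := fun _ _ => rfl
     left_inv := fun f => by ext i; fin_cases i <;> rfl
     right_inv := fun _ => rfl
     map_app' := fun f => by
      simp only [QuadraticMap.prod_apply, QuadraticMap.pi_apply, Fin.sum_univ_four]; ring }⟩

theorem QuadraticMap.Equivalent.prodAssoc (q₁ : QuadraticForm F V₁) (q₂ : QuadraticForm F V₂)
    (q₃ : QuadraticForm F V₃) :
    ((q₁.prod q₂).prod q₃).Equivalent (q₁.prod (q₂.prod q₃)) :=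
  ⟨{ LinearEquiv.prodAssoc F V₁ V₂ V₃ with
     map_app' := fun x => by
      obtain ⟨⟨a, b⟩, c⟩ := x
      simp [QuadraticMap.prod_apply, LinearEquiv.prodAssoc, add_assoc] }⟩

theorem WittEquivalent.of_equivalent {q : QuadraticForm F V₁} {q' : QuadraticForm F V₂}
    {r : QuadraticForm F V₃} {r' : QuadraticForm F V₄} (h : WittEquivalent q' r')
    (hq : q.Equivalent q') (hr : r.Equivalent r') : WittEquivalent q r :=
  IsHyperbolic.of_equivalent h (hq.prod hr)

theorem QuadraticMap.Equivalent.smul_prod (c : F) (q : QuadraticForm F V₁)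
    (q' : QuadraticForm F V₂) : (c • q.prod q').Equivalent ((c • q).prod (c • q')) :=
  ⟨{ LinearEquiv.refl F (V₁ × V₂) with
     map_app' := fun x => by simp [QuadraticMap.prod_apply, mul_add] }⟩

theorem quadPfister_two_equivalent (a b : Fˣ) (c : F) :
    (quadPfister ![a, b] c).Equivalent
      (((binaryForm 1 c).prod ((b : F) • binaryForm 1 c)).prod
        ((a : F) • (binaryForm 1 c).prod ((b : F) • binaryForm 1 c))) := by
  have hS : ∀ S : Finset (Fin 2), S = ∅ ∨ S = {0} ∨ S = {1} ∨ S = {0, 1} := by decide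
  have hu : (Finset.univ : Finset (Finset (Fin 2))) = {∅, {0}, {1}, {0, 1}} := by decide
  have h01 : ({0, 1} : Finset (Fin 2)) ≠ {0} ∧ ({0, 1} : Finset (Fin 2)) ≠ {1} ∧
    ({1} : Finset (Fin 2)) ≠ {0} ∧ ({0, 1} : Finset (Fin 2)) ≠ ∅ := by decide
  refine ⟨{
    toFun := fun f => ((f ∅, f {1}), (f {0}, f {0, 1}))
    invFun := fun y S => if S = ∅ then y.1.1 else if S = {1} then y.1.2 else
      if S = {0} then y.2.1 else y.2.2
    map_add' := fun _ _ => rfl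
    map_smul' := fun _ _ => rfl
    left_inv := fun f => ?_
    right_inv := fun y => ?_
    map_app' := fun f => ?_ }⟩
  · funext S
    rcases hS S with rfl | rfl | rfl | rfl <;> simp [h01]
  · simp [h01]
  · simp only [QuadraticMap.prod_apply, smul_apply, quadPfister, diagTensor, QuadraticMap.pi_apply,
      hu, smul_eq_mul]
    rw [Finset.sum_insert (by decide), Finset.sum_insert (by decide),
      Finset.sum_insert (by decide), Finset.sum_singleton]
    simp
    ring

/-- The form `⟨1, b⟩ ⊗ [1, c]` as a sum of two binary forms. -/
theorem diagTensor_quadPfister_zero_equivalent (a : Fin 0 → Fˣ) (b c : F) :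
    (diagTensor ![1, b] (quadPfister a c)).Equivalent
      ((binaryForm 1 c).prod (b • binaryForm 1 c)) := by
  refine ⟨{
    toFun := fun f => (f 0 ∅, f 1 ∅)
    invFun := fun y => ![fun _ => y.1, fun _ => y.2]
    map_add' := fun _ _ => rfl
    map_smul' := fun _ _ => rfl
    left_inv := fun f => ?_
    right_inv := fun y => rfl
    map_app' := fun f => ?_ }⟩
  · funext i S
    rw [Subsingleton.elim S ∅]
    fin_cases i <;> rfl
  · simp [QuadraticMap.prod_apply, quadPfister, diagTensor, QuadraticMap.pi_apply,
      Subsingleton.elim (default : Finset (Fin 0)) ∅]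

end QuadraticForms

/-! ### Algebras with isomorphic matrix algebras -/

section Cancellation

/-- Over a simple Artinian ring all modules are powers of one simple module, so of two nonzero left
ideals one is a direct summand of the other up to isomorphism. -/
theorem IsSimpleRing.exists_retraction {R : Type*} [Ring R] [IsSimpleRing R] [IsArtinianRing R]
    (I J : Ideal R) [Nontrivial I] [Nontrivial J] :
    (∃ (i : I →ₗ[R] J) (r : J →ₗ[R] I), ∀ x, r (i x) = x) ∨
      ∃ (i : J →ₗ[R] I) (r : I →ₗ[R] J), ∀ x, r (i x) = x := by
  obtain ⟨p, -, S, -, hS, ⟨e⟩⟩ := (IsSimpleRing.isIsotypic R I).submodule_linearEquiv_fun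
  obtain ⟨q, -, T, -, hT, ⟨e'⟩⟩ := (IsSimpleRing.isIsotypic R J).submodule_linearEquiv_fun
  obtain ⟨t⟩ := IsSimpleRing.isIsotypic R R S T
  have key : ∀ {m n : ℕ}, m ≤ n → ∃ (i : (Fin m → S) →ₗ[R] (Fin n → S))
      (r : (Fin n → S) →ₗ[R] (Fin m → S)), ∀ x, r (i x) = x := fun {m n} h =>
    ⟨LinearMap.pi fun j => if hj : (j : ℕ) < m then LinearMap.proj ⟨j, hj⟩ else 0,
      LinearMap.funLeft R S (Fin.castLE h), fun x => by
        ext k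
        simp [LinearMap.funLeft_apply]⟩
  let e'' : J ≃ₗ[R] (Fin q → S) := e'.trans (LinearEquiv.piCongrRight fun _ => t)
  rcases le_total p q with h | h
  · obtain ⟨i, r, hr⟩ := key h
    exact .inl ⟨e''.symm.toLinearMap ∘ₗ i ∘ₗ e.toLinearMap,
      e.symm.toLinearMap ∘ₗ r ∘ₗ e''.toLinearMap, fun x => by simp [hr]⟩
  · obtain ⟨i, r, hr⟩ := key h
    exact .inr ⟨e.symm.toLinearMap ∘ₗ i ∘ₗ e''.toLinearMap,
      e''.symm.toLinearMap ∘ₗ r ∘ₗ e.toLinearMap, fun x => by simp [hr]⟩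

/-- If `R e` is a direct summand of `R f`, the inclusion and the projection are right multiplications
by elements `u` of `e R f` and `v` of `f R e`. -/
theorem IsIdempotentElem.exists_mul_eq_of_retraction {R : Type*} [Ring R] {e f : R}
    (hf : IsIdempotentElem f)
    (i : Ideal.span {e} →ₗ[R] Ideal.span {f}) (r : Ideal.span {f} →ₗ[R] Ideal.span {e})
    (h : ∀ x, r (i x) = x) : ∃ u v : R, u * f = u ∧ f * v = v ∧ u * v = e := by
  let e₀ : Ideal.span {e} := ⟨e, Ideal.mem_span_singleton_self e⟩
  let f₀ : Ideal.span {f} := ⟨f, Ideal.mem_span_singleton_self f⟩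
  have huf : (i e₀ : R) * f = i e₀ := by
    obtain ⟨c, hc⟩ := Ideal.mem_span_singleton'.mp (i e₀).2
    rw [← hc, mul_assoc, hf.eq]
  refine ⟨i e₀, r f₀, huf, ?_, ?_⟩
  · have : f • f₀ = f₀ := Subtype.ext hf.eq
    conv_rhs => rw [← this, map_smul]
    rfl
  · have : (i e₀ : R) • f₀ = i e₀ := Subtype.ext huf
    calc (i e₀ : R) * r f₀ = (((i e₀ : R) • r f₀ : Ideal.span {e}) : R) := rfl
      _ = e := by rw [← map_smul, this, h]

open Matrix in
/-- The map `a ↦ v a w` between the corners of two matrix algebras is injective and multiplicative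
when `w v` is the unit of the first corner; it is an isomorphism when the dimensions agree. -/
theorem nonempty_algEquiv_of_matrix_corner {F A B m n : Type*} [Field F] [Ring A] [Ring B]
    [Algebra F A] [Algebra F B] [FiniteDimensional F A] [FiniteDimensional F B]
    [Fintype m] [DecidableEq m] [Fintype n] [DecidableEq n]
    (hd : Module.finrank F A = Module.finrank F B)
    (φ : Matrix m m A ≃ₐ[F] Matrix n n B) (k : m) (l : n) (w v : Matrix n n B)
    (hw : w * single l l 1 = w) (hv : single l l 1 * v = v)
    (hwv : w * v = φ (single k k 1)) : Nonempty (A ≃ₐ[F] B) := by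
  let g : A →ₗ[F] B :=
    { toFun := fun a => (v * φ (single k k a) * w) l l
      map_add' := fun a b => by
        simp only [single_add, map_add, mul_add, add_mul, Matrix.add_apply]
      map_smul' := fun c a => by
        simp only [← smul_single, map_smul, mul_smul_comm, smul_mul_assoc, Matrix.smul_apply,
          RingHom.id_apply] }
  have hg : ∀ a, single l l (g a) = v * φ (single k k a) * w := fun a => by
    -- `v φ(a) w` lies in the corner of the second matrix algebra
    have h1 : v * φ (single k k a) * w =
        single l l 1 * (v * φ (single k k a) * w) * single l l 1 := by
      conv_lhs => rw [← hv, ← hw]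
      simp only [mul_assoc]
    rw [h1]
    ext i j
    simp only [g, LinearMap.coe_mk, AddHom.coe_mk, single_mul_mul_single, one_mul, mul_one]
  have hmul : ∀ a b, g (a * b) = g a * g b := fun a b => by
    suffices h : single l l (g (a * b)) = single l l (g a * g b) by
      simpa using congrFun₂ h l l
    have h1 : single l l (g a * g b) = single l l (g a) * single l l (g b) := by simp
    rw [h1, hg, hg, hg]
    calc v * φ (single k k (a * b)) * w
        = v * φ (single k k a * single k k 1 * single k k b) * w := by simp
      _ = _ := by rw [map_mul, map_mul, ← hwv]; simp only [mul_assoc]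
  have hinj : Function.Injective g := by
    refine (injective_iff_map_eq_zero g).mpr fun a ha => ?_
    have h1 : φ (single k k 1 * single k k a * single k k 1) = w * single l l (g a) * v := by
      rw [hg, map_mul, map_mul, ← hwv]
      simp only [mul_assoc]
    rw [ha] at h1
    simpa using congrFun₂ (φ.injective (h1.trans (by simp : _ = φ 0))) k k
  let E := LinearEquiv.ofInjectiveOfFinrankEq g hinj hd
  -- a surjective multiplicative map preserves the unit
  refine ⟨AlgEquiv.ofLinearEquiv E ?_ hmul⟩
  obtain ⟨a, ha⟩ := E.surjective 1
  calc E 1 = E 1 * E a := by rw [ha, mul_one]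
    _ = E (1 * a) := (hmul 1 a).symm
    _ = 1 := by rw [one_mul, ha]

open Matrix in
/-- The uniqueness part of the Artin–Wedderburn theorem for algebras of the same dimension: simple
algebras with isomorphic matrix algebras are isomorphic. -/
theorem nonempty_algEquiv_of_matrix {F A B m n : Type*} [Field F] [Ring A] [Ring B]
    [Algebra F A] [Algebra F B] [FiniteDimensional F A] [FiniteDimensional F B]
    [Nontrivial A] [IsSimpleRing B]
    [Fintype m] [DecidableEq m] [Fintype n] [DecidableEq n] [Nonempty m] [Nonempty n]
    (hd : Module.finrank F A = Module.finrank F B)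
    (φ : Matrix m m A ≃ₐ[F] Matrix n n B) : Nonempty (A ≃ₐ[F] B) := by
  obtain ⟨k⟩ := ‹Nonempty m›
  obtain ⟨l⟩ := ‹Nonempty n›
  have : Nonempty n := ⟨l⟩
  have : IsArtinianRing (Matrix n n B) := IsArtinianRing.of_finite F _
  have hE : IsIdempotentElem (single k k (1 : A)) := by simp [IsIdempotentElem]
  have he : IsIdempotentElem (φ (single k k 1)) := hE.map φ
  have hf : IsIdempotentElem (single l l (1 : B)) := by simp [IsIdempotentElem]
  have he0 : φ (single k k 1) ≠ 0 := fun h => by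
    simpa using congrFun₂ (φ.injective (h.trans (map_zero φ).symm)) k k
  have hf0 : single l l (1 : B) ≠ 0 := fun h => by simpa using congrFun₂ h l l
  have hn : ∀ x : Matrix n n B, x ≠ 0 → Nontrivial (Ideal.span {x}) := fun x hx =>
    ⟨⟨x, Ideal.mem_span_singleton_self x⟩, 0, fun h => hx (congrArg Subtype.val h)⟩
  have := hn _ he0
  have := hn _ hf0
  rcases IsSimpleRing.exists_retraction (Ideal.span {φ (single k k 1)})
    (Ideal.span {single l l (1 : B)}) with ⟨i, r, h⟩ | ⟨i, r, h⟩
  · obtain ⟨w, v, hw, hv, hwv⟩ := hf.exists_mul_eq_of_retraction i r h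
    exact nonempty_algEquiv_of_matrix_corner hd φ k l w v hw hv hwv
  · obtain ⟨w, v, hw, hv, hwv⟩ := he.exists_mul_eq_of_retraction i r h
    refine (nonempty_algEquiv_of_matrix_corner hd.symm φ.symm l k (φ.symm w) (φ.symm v)
      ?_ ?_ ?_).map AlgEquiv.symm
    · apply φ.injective; simpa using hw
    · apply φ.injective; simpa using hv
    · rw [← map_mul, hwv]

end Cancellation

/-! ### Quaternion algebras and their norm forms -/

section Quaternion

variable {F : Type*} [Field F]

theorem Quat.finrank_eq (a : F) (b : Fˣ) : Module.finrank F (Quat a b) = 4 :=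
  QuaternionAlgebra.finrank_eq_four _ _ _

variable [CharP F 2]

/-- A quaternion algebra is isomorphic to any four-dimensional algebra that contains two elements
satisfying the relations between its generators. -/
theorem Quat.nonempty_algEquiv_of_basis {A : Type*} [Ring A] [Algebra F A]
    (hA : Module.finrank F A = 4) {a : F} {b : Fˣ}
    (B : QuaternionAlgebra.Basis A a 1 (b : F)) : Nonempty (Quat a b ≃ₐ[F] A) := by
  have := quat_isSimple a b
  have : FiniteDimensional F A := .of_finrank_pos (by omega)
  have : Nontrivial A := Module.nontrivial_of_finrank_pos (R := F) (by omega)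
  have hinj : Function.Injective B.liftHom := B.liftHom.toRingHom.injective
  exact ⟨AlgEquiv.ofBijective B.liftHom
    ⟨hinj, (LinearMap.injective_iff_surjective_of_finrank_eq_finrank
      (f := B.liftHom.toLinearMap) ((Quat.finrank_eq a b).trans hA.symm)).mp hinj⟩⟩

theorem normForm_apply (a : F) (b : Fˣ) (z : Quat a b) :
    normForm a b z = z.re ^ 2 + z.re * z.imI + a * z.imI ^ 2 +
      b * (z.imJ ^ 2 + z.imJ * z.imK + a * z.imK ^ 2) := by
  have h2 : (2 : F) = 0 := CharTwo.two_eq_zero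
  change (z * star z).re = _
  obtain ⟨p, q, r, s⟩ := z
  simp
  linear_combination (-(a * q ^ 2) - b * r ^ 2 - b * r * s) * h2

/-- The Cayley–Hamilton relation in a quaternion algebra. -/
theorem Quat.mul_self (a : F) (b : Fˣ) (z : Quat a b) :
    z * z = z.imI • z + normForm a b z • 1 := by
  have h2 : (2 : F) = 0 := CharTwo.two_eq_zero
  rw [normForm_apply]
  obtain ⟨p, q, r, s⟩ := z
  ext <;> simp
  · linear_combination (-(a * b * s ^ 2) - p * q) * h2
  · linear_combination p * q * h2
  · linear_combination p * r * h2
  · linear_combination p * s * h2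

/-- An isomorphism of quaternion algebras preserves the norm, as the norm of a non-scalar element
is the constant term of its minimal polynomial. -/
theorem normForm_equivalent_of_algEquiv {a a' : F} {b b' : Fˣ} (e : Quat a b ≃ₐ[F] Quat a' b') :
    (normForm a b).Equivalent (normForm a' b') := by
  refine ⟨{ e.toLinearEquiv with map_app' := fun z => ?_ }⟩
  change normForm a' b' (e z) = normForm a b z
  by_cases hz : ∃ r : F, z = algebraMap F _ r
  · obtain ⟨r, rfl⟩ := hz
    rw [AlgEquiv.commutes]
    simp [normForm_apply, QuaternionAlgebra.algebraMap_eq]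
  · have h1 := congrArg e (Quat.mul_self a b z)
    rw [map_mul, map_add, map_smul, map_smul, map_one, Quat.mul_self] at h1
    have h2 : ((e z).imI - z.imI) • e z =
        (normForm a b z - normForm a' b' (e z)) • (1 : Quat a' b') := by
      rw [sub_smul, sub_smul]
      linear_combination (norm := abel) h1
    have h3 : (e z).imI - z.imI = 0 := by
      by_contra hne
      refine hz ⟨((e z).imI - z.imI)⁻¹ * (normForm a b z - normForm a' b' (e z)), e.injective ?_⟩
      rw [AlgEquiv.commutes, Algebra.algebraMap_eq_smul_one, mul_smul, ← h2, inv_smul_smul₀ hne]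
    rw [h3, zero_smul, eq_comm, smul_eq_zero, sub_eq_zero] at h2
    exact (h2.resolve_right one_ne_zero).symm

theorem normForm_equivalent_prod (a : F) (b : Fˣ) :
    (normForm a b).Equivalent ((binaryForm 1 a).prod ((b : F) • binaryForm 1 a)) :=
  ⟨{ toFun := fun z => ((z.re, z.imI), (z.imJ, z.imK))
     invFun := fun y => ⟨y.1.1, y.1.2, y.2.1, y.2.2⟩
     map_add' := fun _ _ => rfl
     map_smul' := fun _ _ => rfl
     left_inv := fun _ => rfl
     right_inv := fun _ => rfl
     map_app' := fun z => by
      simp [normForm_apply, QuadraticMap.prod_apply, binaryForm_apply] }⟩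

end Quaternion

/-! ### Isomorphisms between quaternion algebras -/

section Split

variable {F : Type*} [Field F] [CharP F 2]

/-- The elements `x + s + t y` and `y` of `[a, b)` satisfy the relations of the algebra
`[a + (s² + s) + t² b, b)`. -/
theorem Quat.nonempty_algEquiv_add (a s t : F) (b : Fˣ) :
    Nonempty (Quat (a + (s ^ 2 + s) + t ^ 2 * b) b ≃ₐ[F] Quat a b) := by
  have h2 : (2 : F) = 0 := CharTwo.two_eq_zero
  refine Quat.nonempty_algEquiv_of_basis (Quat.finrank_eq a b)
    { i := ⟨s, 1, t, 0⟩
      j := ⟨0, 0, 1, 0⟩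
      k := ⟨s, 1, t, 0⟩ * ⟨0, 0, 1, 0⟩
      i_mul_i := ?_
      j_mul_j := ?_
      i_mul_j := rfl
      j_mul_i := ?_ }
  · ext <;> simp
    · linear_combination (-s) * h2
    · linear_combination (s) * h2
    · linear_combination (s * t) * h2
  · ext <;> simp
  · ext <;> simp
    · linear_combination (t * b) * h2
    · linear_combination (s) * h2

/-- If `d = b + s²`, then `[d, b)` is isomorphic to `[d² / b, d)`: in terms of the generators `x`, `y`
of the latter, `x + (s / d) x y` and `y + s` satisfy the relations of `[d, b)`. -/
theorem Quat.nonempty_algEquiv_swap (s : F) (b d : Fˣ) (hd : (d : F) = b + s ^ 2) :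
    Nonempty (Quat (d : F) b ≃ₐ[F] Quat ((d : F) ^ 2 * (b : F)⁻¹) d) := by
  have h2 : (2 : F) = 0 := CharTwo.two_eq_zero
  have hb := b.ne_zero
  have hd0 := d.ne_zero
  refine Quat.nonempty_algEquiv_of_basis (Quat.finrank_eq _ _)
    { i := ⟨0, 1, 0, s * (d : F)⁻¹⟩
      j := ⟨s, 0, 1, 0⟩
      k := ⟨0, 1, 0, s * (d : F)⁻¹⟩ * ⟨s, 0, 1, 0⟩
      i_mul_i := ?_
      j_mul_j := ?_
      i_mul_j := rfl
      j_mul_i := ?_ }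
  · ext <;> simp
    field_simp
    linear_combination hd
  · ext <;> simp
    · linear_combination (s ^ 2) * h2 + hd
    · linear_combination s * h2
  · ext <;> simp <;> field_simp
    · linear_combination s * h2
    · linear_combination (s ^ 2) * h2

/-- The algebra `[t² + t, b)` is split: the polynomial `X² + X + (t² + t)` has the roots `t`, `t + 1`,
which become the eigenvalues of the first generator. -/
theorem Quat.nonempty_algEquiv_matrix (t : F) (b : Fˣ) :
    Nonempty (Quat (t ^ 2 + t) b ≃ₐ[F] Matrix (Fin 2) (Fin 2) F) := by
  have h2 : (2 : F) = 0 := CharTwo.two_eq_zero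
  refine Quat.nonempty_algEquiv_of_basis (by simp [Module.finrank_matrix])
    { i := !![t + 1, 0; 0, t]
      j := !![0, (b : F); 1, 0]
      k := !![t + 1, 0; 0, t] * !![0, (b : F); 1, 0]
      i_mul_i := ?_
      j_mul_j := ?_
      i_mul_j := rfl
      j_mul_i := ?_ }
  · ext i j; fin_cases i <;> fin_cases j <;> simp <;> ring_nf
    linear_combination (-t) * h2
  · ext i j; fin_cases i <;> fin_cases j <;> simp
  · ext i j; fin_cases i <;> fin_cases j <;> simp
    · linear_combination (t * b) * h2
    · linear_combination t * h2

/-- The algebra `[a, 1)` is split: it acts on the plane `F[x]` by multiplication by `x` and by the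
conjugation `x ↦ x + 1`. -/
theorem Quat.nonempty_algEquiv_matrix_one (a : F) :
    Nonempty (Quat a 1 ≃ₐ[F] Matrix (Fin 2) (Fin 2) F) := by
  refine Quat.nonempty_algEquiv_of_basis (by simp [Module.finrank_matrix])
    { i := !![0, a; 1, 1]
      j := !![1, 1; 0, 1]
      k := !![0, a; 1, 1] * !![1, 1; 0, 1]
      i_mul_i := ?_
      j_mul_j := ?_
      i_mul_j := rfl
      j_mul_i := ?_ }
  · ext i j; fin_cases i <;> fin_cases j <;> simp
  · ext i j; fin_cases i <;> fin_cases j <;> simp [CharTwo.add_self_eq_zero]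
  · ext i j; fin_cases i <;> fin_cases j <;>
      simp [CharTwo.add_self_eq_zero, CharTwo.sub_eq_add, add_comm]

theorem Quat.nonempty_algEquiv_mul_sq (a : F) (b c : Fˣ) :
    Nonempty (Quat a (b * c ^ 2) ≃ₐ[F] Quat a b) := by
  refine Quat.nonempty_algEquiv_of_basis (Quat.finrank_eq _ _)
    { i := ⟨0, 1, 0, 0⟩
      j := ⟨0, 0, c, 0⟩
      k := ⟨0, 1, 0, 0⟩ * ⟨0, 0, c, 0⟩
      i_mul_i := by ext <;> simp
      j_mul_j := by ext <;> simp; ring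
      i_mul_j := rfl
      j_mul_i := by ext <;> simp }

omit [CharP F 2] in
theorem Quat.nonempty_algEquiv_mulOpposite (a : F) (b : Fˣ) :
    Nonempty ((Quat a b)ᵐᵒᵖ ≃ₐ[F] Quat a b) :=
  ⟨(QuaternionAlgebra.starAe (R := F) (c₁ := a) (c₂ := 1) (c₃ := (b : F))).symm⟩

end Split

/-! ### The tensor product of two quaternion algebras -/

section Tensor

variable {F : Type*} [Field F]

theorem QuaternionAlgebra.Basis.commute_liftHom {A : Type*} [Ring A] [Algebra F A] {a b c : F}
    (B : QuaternionAlgebra.Basis A a b c) {w : A} (hi : Commute w B.i) (hj : Commute w B.j)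
    (z : ℍ[F, a, b, c]) : Commute w (B.liftHom z) := by
  have hk : Commute w B.k := B.i_mul_j ▸ hi.mul_right hj
  have h1 : Commute w (algebraMap F A z.re) := (Algebra.commutes z.re w).symm
  exact ((h1.add_right (hi.smul_right _)).add_right (hj.smul_right _)).add_right (hk.smul_right _)

section MatrixBasis

variable {A : Type*} [Ring A] [Algebra F A] {a : F} {b b' : Fˣ}
  (q : QuaternionAlgebra.Basis A a 1 ((b * b' : Fˣ) : F))

/-- A copy of `[a, b)` in the `2 × 2` matrices over an algebra with generators `x`, `z` that satisfy
the relations of `[a, b b')`. The generators of the copy are the scalar matrix `x` and the product of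
the scalar matrix `z` with the inverse of the second generator of
`QuaternionAlgebra.Basis.matrixRight`. -/
@[simps]
def QuaternionAlgebra.Basis.matrixLeft :
    QuaternionAlgebra.Basis (Matrix (Fin 2) (Fin 2) A) a 1 (b : F) where
  i := !![q.i, 0; 0, q.i]
  j := !![0, q.j; (b' : F)⁻¹ • q.j, 0]
  k := !![0, q.k; (b' : F)⁻¹ • q.k, 0]
  i_mul_i := by
    ext i j
    fin_cases i <;> fin_cases j <;> simp
  j_mul_j := by
    ext i j
    fin_cases i <;> fin_cases j <;> simp [smul_smul, mul_comm]
  i_mul_j := by simp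
  j_mul_i := by
    ext i j
    fin_cases i <;> fin_cases j <;> simp [smul_sub]

variable [CharP A 2]

/-- A copy of `[a, b')` in the `2 × 2` matrices over an algebra with generators `x`, `z` that satisfy
the relations of `[a, b b')`; it commutes with the copy of `[a, b)` in
`QuaternionAlgebra.Basis.matrixLeft`. The first generator is the diagonal matrix with the entries
`x + 1`, `x`; its sum with the scalar matrix `x` is a matrix unit. -/
@[simps]
def QuaternionAlgebra.Basis.matrixRight :
    QuaternionAlgebra.Basis (Matrix (Fin 2) (Fin 2) A) a 1 (b' : F) where
  i := !![q.i + 1, 0; 0, q.i]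
  j := !![0, algebraMap F A b'; 1, 0]
  k := !![0, (b' : F) • q.i + (b' : F) • 1; q.i, 0]
  i_mul_i := by
    ext i j
    fin_cases i <;> fin_cases j <;> 
      simp [mul_add, add_mul, CharTwo.add_self_eq_zero, add_comm]
    rw [← add_assoc, CharTwo.add_self_eq_zero, zero_add]
  j_mul_j := by
    ext i j
    fin_cases i <;> fin_cases j <;> simp [Algebra.smul_def]
  i_mul_j := by simp [Algebra.algebraMap_eq_smul_one]
  j_mul_i := by
    ext i j
    fin_cases i <;> fin_cases j <;>
      simp [CharTwo.sub_eq_add, Algebra.algebraMap_eq_smul_one, add_comm]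
    rw [add_left_comm, CharTwo.add_self_eq_zero, add_zero]

theorem QuaternionAlgebra.Basis.commute_matrixLeft_i_matrixRight_i :
    Commute q.matrixLeft.i q.matrixRight.i := by
  ext i j
  fin_cases i <;> fin_cases j <;> simp [mul_add, add_mul]

theorem QuaternionAlgebra.Basis.commute_matrixLeft_i_matrixRight_j :
    Commute q.matrixLeft.i q.matrixRight.j := by
  ext i j
  fin_cases i <;> fin_cases j <;> simp [Algebra.algebraMap_eq_smul_one]

theorem QuaternionAlgebra.Basis.commute_matrixLeft_j_matrixRight_i :
    Commute q.matrixLeft.j q.matrixRight.i := by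
  ext i j
  fin_cases i <;> fin_cases j <;>
    simp [mul_add, add_mul, CharTwo.sub_eq_add, ← add_assoc, CharTwo.add_self_eq_zero, add_comm]

theorem QuaternionAlgebra.Basis.commute_matrixLeft_j_matrixRight_j :
    Commute q.matrixLeft.j q.matrixRight.j := by
  ext i j
  fin_cases i <;> fin_cases j <;> simp [Algebra.algebraMap_eq_smul_one, smul_smul]

/-- A subalgebra that contains the generators of both copies contains the matrix units and the scalar
matrices, hence everything. -/
theorem QuaternionAlgebra.Basis.eq_top_of_matrix_mem (hq : Function.Surjective q.liftHom)
    (S : Subalgebra F (Matrix (Fin 2) (Fin 2) A))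
    (hi : q.matrixLeft.i ∈ S) (hj : q.matrixLeft.j ∈ S)
    (hi' : q.matrixRight.i ∈ S) (hj' : q.matrixRight.j ∈ S) : S = ⊤ := by
  have h00 : Matrix.single 0 0 1 ∈ S := by
    convert add_mem hi hi' using 1
    ext i j
    fin_cases i <;> fin_cases j <;> simp [← add_assoc, CharTwo.add_self_eq_zero]
  have h10 : Matrix.single 1 0 1 ∈ S := by
    convert mul_mem hj' h00 using 1
    ext i j
    fin_cases i <;> fin_cases j <;> simp [Matrix.mul_apply]
  have h01 : Matrix.single 0 1 1 ∈ S := by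
    convert S.smul_mem (mul_mem h00 hj') (b' : F)⁻¹ using 1
    ext i j
    fin_cases i <;> fin_cases j <;>
      simp [Matrix.mul_apply, Algebra.algebraMap_eq_smul_one, smul_smul]
  have hs : ∀ w : A, Matrix.scalar (Fin 2) w ∈ S := fun w => by
    obtain ⟨w, rfl⟩ := hq w
    convert add_mem (add_mem (add_mem (S.algebraMap_mem w.re) (S.smul_mem hi w.imI))
      (S.smul_mem (mul_mem hj hj') w.imJ))
      (S.smul_mem (mul_mem hi (mul_mem hj hj')) w.imK) using 1
    ext i j
    fin_cases i <;> fin_cases j <;>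
      simp [QuaternionAlgebra.Basis.lift, Algebra.algebraMap_eq_smul_one, smul_smul]
  refine eq_top_iff.mpr fun M _ => ?_
  have h0 : ∀ i : Fin 2, Matrix.single i 0 1 ∈ S := fun i => by
    fin_cases i
    exacts [h00, h10]
  have h1 : ∀ j : Fin 2, Matrix.single 0 j 1 ∈ S := fun j => by
    fin_cases j
    exacts [h00, h01]
  rw [Matrix.matrix_eq_sum_single M]
  refine sum_mem fun i _ => sum_mem fun j _ => ?_
  convert mul_mem (mul_mem (h0 i) (hs (M i j))) (h1 j) using 1
  ext k l
  simp only [Matrix.scalar_apply, Matrix.mul_apply, Matrix.single_apply, Matrix.diagonal_apply]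
  by_cases hk : i = k <;> by_cases hl : j = l <;> simp [hk, hl]

end MatrixBasis

variable [CharP F 2]

/-- The tensor product of `[a, b)` and `[a, b')` is Brauer equivalent to `[a, b b')`. -/
theorem Quat.nonempty_tensor_algEquiv (a : F) (b b' : Fˣ) :
    Nonempty (Quat a b ⊗[F] Quat a b' ≃ₐ[F] Matrix (Fin 2) (Fin 2) (Quat a (b * b'))) := by
  have : CharP (Quat a (b * b')) 2 :=
    charP_of_injective_algebraMap (FaithfulSMul.algebraMap_injective F _) 2
  let q := QuaternionAlgebra.Basis.self F (c₁ := a) (c₂ := 1) (c₃ := ((b * b' : Fˣ) : F))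
  have hq : Function.Surjective q.liftHom := fun w => ⟨w, by
    ext <;> simp [q, QuaternionAlgebra.Basis.lift, QuaternionAlgebra.algebraMap_eq]⟩
  let B := q.matrixLeft
  let B' := q.matrixRight
  let f := Algebra.TensorProduct.lift B.liftHom B'.liftHom fun u v =>
    B'.commute_liftHom
      (B.commute_liftHom q.commute_matrixLeft_i_matrixRight_i.symm
        q.commute_matrixLeft_j_matrixRight_i.symm u).symm
      (B.commute_liftHom q.commute_matrixLeft_i_matrixRight_j.symm
        q.commute_matrixLeft_j_matrixRight_j.symm u).symm v
  have hB : ∀ u, B.liftHom u ∈ f.range := fun u =>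
    ⟨u ⊗ₜ 1, by simp [f, QuaternionAlgebra.Basis.lift_one]⟩
  have hB' : ∀ v, B'.liftHom v ∈ f.range := fun v =>
    ⟨1 ⊗ₜ v, by simp [f, QuaternionAlgebra.Basis.lift_one]⟩
  have hf : Function.Surjective f := by
    rw [← AlgHom.range_eq_top]
    refine q.eq_top_of_matrix_mem hq _ ?_ ?_ ?_ ?_
    · simpa [QuaternionAlgebra.Basis.lift, B] using hB ⟨0, 1, 0, 0⟩
    · simpa [QuaternionAlgebra.Basis.lift, B] using hB ⟨0, 0, 1, 0⟩
    · simpa [QuaternionAlgebra.Basis.lift, B'] using hB' ⟨0, 1, 0, 0⟩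
    · simpa [QuaternionAlgebra.Basis.lift, B'] using hB' ⟨0, 0, 1, 0⟩
  have hd : Module.finrank F (Quat a b ⊗[F] Quat a b') =
      Module.finrank F (Matrix (Fin 2) (Fin 2) (Quat a (b * b'))) := by
    rw [Module.finrank_tensorProduct, Module.finrank_matrix]
    simp [Quat.finrank_eq]
  exact ⟨AlgEquiv.ofBijective f
    ⟨(LinearMap.injective_iff_surjective_of_finrank_eq_finrank (f := f.toLinearMap) hd).mpr hf, hf⟩⟩

end Tensor

/-! ### Brauer classes of quaternion algebras -/

section Brauer

open Matrix

theorem IsBrauerEquivalent.of_algEquiv {F : Type u} [Field F] {A B : CSA.{u, u} F}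
    (e : A ≃ₐ[F] B) : IsBrauerEquivalent A B :=
  ⟨1, 1, one_ne_zero, one_ne_zero, ⟨e.mapMatrix⟩⟩

theorem IsBrauerEquivalent.of_algEquiv_matrix {F : Type u} [Field F] {A B : CSA.{u, u} F} {n : ℕ}
    (hn : n ≠ 0) (e : A ≃ₐ[F] Matrix (Fin n) (Fin n) B) : IsBrauerEquivalent A B :=
  ⟨1, n, one_ne_zero, hn, ⟨e.mapMatrix.trans <| (compAlgEquiv (Fin 1) (Fin n) B F).trans <|
    reindexAlgEquiv F B (Equiv.uniqueProd (Fin n) (Fin 1))⟩⟩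

/-- Brauer equivalence is compatible with tensor products. -/
theorem IsBrauerEquivalent.of_tensor {F : Type u} [Field F] {A A' B B' C C' : CSA.{u, u} F}
    (hA : IsBrauerEquivalent A A') (hB : IsBrauerEquivalent B B')
    (e : C ≃ₐ[F] A ⊗[F] B) (e' : C' ≃ₐ[F] A' ⊗[F] B') : IsBrauerEquivalent C C' := by
  obtain ⟨n, m, hn, hm, ⟨f⟩⟩ := hA
  obtain ⟨p, q, hp, hq, ⟨g⟩⟩ := hB
  have key : ∀ (k l : ℕ) (X Y Z : CSA.{u, u} F) (_ : Z ≃ₐ[F] X ⊗[F] Y),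
      Nonempty (Matrix (Fin (k * l)) (Fin (k * l)) Z ≃ₐ[F]
        Matrix (Fin k) (Fin k) X ⊗[F] Matrix (Fin l) (Fin l) Y) := fun k l X Y Z h =>
    ⟨(reindexAlgEquiv F Z finProdFinEquiv.symm).trans <| h.mapMatrix.trans
      (kroneckerTMulAlgEquiv (Fin k) (Fin l) F F X Y).symm⟩
  obtain ⟨h⟩ := key n p A B C e
  obtain ⟨h'⟩ := key m q A' B' C' e'
  exact ⟨n * p, m * q, mul_ne_zero hn hp, mul_ne_zero hm hq,
    ⟨h.trans <| (Algebra.TensorProduct.congr f g).trans h'.symm⟩⟩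

theorem IsBrauerEquivalent.of_mulOpposite {F : Type u} [Field F] {A A' B B' : CSA.{u, u} F}
    (hA : IsBrauerEquivalent A A') (e : B ≃ₐ[F] Aᵐᵒᵖ) (e' : B' ≃ₐ[F] A'ᵐᵒᵖ) :
    IsBrauerEquivalent B B' := by
  obtain ⟨n, m, hn, hm, ⟨f⟩⟩ := hA
  have key : ∀ (k : ℕ) (X Y : CSA.{u, u} F) (_ : Y ≃ₐ[F] Xᵐᵒᵖ),
      Nonempty (Matrix (Fin k) (Fin k) Y ≃ₐ[F] (Matrix (Fin k) (Fin k) X)ᵐᵒᵖ) := fun k X Y h =>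
    ⟨h.mapMatrix.trans AlgEquiv.mopMatrix⟩
  obtain ⟨h⟩ := key n A B e
  obtain ⟨h'⟩ := key m A' B' e'
  exact ⟨n, m, hn, hm, ⟨h.trans <| (AlgEquiv.op f).trans h'.symm⟩⟩

variable {F : Type u} [Field F] [CharP F 2]

/-- The quaternion algebra `[a, b)` as a central simple algebra. -/
abbrev quatCSA (a : F) (b : Fˣ) : CSA.{u, u} F :=
  haveI := quat_isCentral a b
  haveI := quat_isSimple a b
  CSA.mk (AlgCat.of F (Quat a b))

theorem brauerClass_quatCSA (a : F) (b : Fˣ) : (quatCSA a b).brauerClass = quatClass a b := rfl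

omit [CharP F 2] in
theorem CSA.brauerClass_eq_iff {A B : CSA.{u, u} F} :
    A.brauerClass = B.brauerClass ↔ IsBrauerEquivalent A B :=
  Quotient.eq (r := Brauer.CSA_Setoid F)

/-- Quaternion algebras with the same Brauer class are isomorphic, as their dimensions agree. -/
theorem quatClass_eq_iff {a a' : F} {b b' : Fˣ} :
    quatClass a b = quatClass a' b' ↔ Nonempty (Quat a b ≃ₐ[F] Quat a' b') := by
  rw [← brauerClass_quatCSA, ← brauerClass_quatCSA, CSA.brauerClass_eq_iff]
  refine ⟨fun ⟨n, m, hn, hm, ⟨e⟩⟩ => ?_, fun ⟨e⟩ => IsBrauerEquivalent.of_algEquiv e⟩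
  have := quat_isSimple a b
  have := quat_isSimple a' b'
  have : NeZero n := ⟨hn⟩
  have : NeZero m := ⟨hm⟩
  exact nonempty_algEquiv_of_matrix
    ((Quat.finrank_eq a b).trans (Quat.finrank_eq a' b').symm) e

theorem isBrauerProduct_quatClass (a : F) (b b' : Fˣ) :
    IsBrauerProduct (quatClass a b) (quatClass a b') (quatClass a (b * b')) := by
  obtain ⟨e⟩ := Quat.nonempty_tensor_algEquiv a b b'
  have := quat_isCentral a (b * b')
  have := quat_isSimple a (b * b')
  let C : CSA.{u, u} F := CSA.mk (AlgCat.of F (Matrix (Fin 2) (Fin 2) (Quat a (b * b'))))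
  refine ⟨quatCSA a b, quatCSA a b', C, rfl, rfl, ?_, ⟨e.symm⟩⟩
  rw [← brauerClass_quatCSA, CSA.brauerClass_eq_iff]
  exact IsBrauerEquivalent.of_algEquiv_matrix two_ne_zero AlgEquiv.refl

omit [CharP F 2] in
theorem IsBrauerProduct.unique {x y z z' : BrauerGroup.{u, u} F} (h : IsBrauerProduct x y z)
    (h' : IsBrauerProduct x y z') : z = z' := by
  obtain ⟨A, B, C, rfl, rfl, rfl, ⟨e⟩⟩ := h
  obtain ⟨A', B', C', hA, hB, rfl, ⟨e'⟩⟩ := h'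
  rw [CSA.brauerClass_eq_iff] at hA hB ⊢
  exact IsBrauerEquivalent.of_tensor (IsBrauerEquivalent.symm hA) (IsBrauerEquivalent.symm hB) e e'

theorem IsBrauerProduct.quatClass_eq {a : F} {b b' : Fˣ} {z : BrauerGroup.{u, u} F}
    (h : IsBrauerProduct (quatClass a b) (quatClass a b') z) : z = quatClass a (b * b') :=
  h.unique (isBrauerProduct_quatClass a b b')

theorem quatClass_mul_congr {a : F} {b b' c c' : Fˣ} (h : quatClass a b = quatClass a b')
    (h' : quatClass a c = quatClass a c') : quatClass a (b * c) = quatClass a (b' * c') := by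
  have := isBrauerProduct_quatClass a b c
  rw [h, h'] at this
  exact this.quatClass_eq

theorem quatClass_mul_sq (a : F) (b c : Fˣ) : quatClass a (b * c ^ 2) = quatClass a b :=
  quatClass_eq_iff.mpr (Quat.nonempty_algEquiv_mul_sq a b c)

theorem brauerClass_eq_quatClass_one {A : CSA.{u, u} F} (e : A ≃ₐ[F] F) (a : F) :
    A.brauerClass = quatClass a 1 := by
  obtain ⟨e'⟩ := Quat.nonempty_algEquiv_matrix_one a
  rw [← brauerClass_quatCSA, eq_comm, CSA.brauerClass_eq_iff]
  exact IsBrauerEquivalent.of_algEquiv_matrix two_ne_zero (e'.trans e.symm.mapMatrix)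

theorem brauerClass_eq_of_mulOpposite {A B : CSA.{u, u} F} {a : F} {b : Fˣ}
    (h : A.brauerClass = quatClass a b) (e : B ≃ₐ[F] Aᵐᵒᵖ) : B.brauerClass = quatClass a b := by
  obtain ⟨e'⟩ := Quat.nonempty_algEquiv_mulOpposite a b
  rw [← brauerClass_quatCSA, CSA.brauerClass_eq_iff] at h ⊢
  exact IsBrauerEquivalent.of_mulOpposite h e e'.symm

theorem quatClass_pow_mul_pow_mem (a : F) (b c : Fˣ) (m n : ℕ) :
    quatClass a (b ^ m * c ^ n) ∈ Set.range fun i : Fin 4 => quatClass a (![1, b, c, b * c] i) := by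
  have key : ∀ (i : Fin 4) (k l : ℕ), b ^ m * c ^ n = ![1, b, c, b * c] i * (b ^ k * c ^ l) ^ 2 →
      quatClass a (b ^ m * c ^ n) ∈
        Set.range fun i : Fin 4 => quatClass a (![1, b, c, b * c] i) := fun i k l h =>
    ⟨i, by rw [h, quatClass_mul_sq]⟩
  obtain ⟨k, rfl | rfl⟩ := Nat.even_or_odd' m <;> obtain ⟨l, rfl | rfl⟩ := Nat.even_or_odd' n
  · exact key 0 k l (by ext; simp; ring)
  · exact key 2 k l (by ext; simp; ring)
  · exact key 1 k l (by ext; simp; ring)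
  · exact key 3 k l (by ext; simp; ring)

/-- The subgroup generated by `[a, b)` and `[a, c)` consists of the classes of `[a, 1)`, `[a, b)`,
`[a, c)` and `[a, b c)`. -/
theorem brauerSubgroup_pair_eq (a : F) (b c : Fˣ) :
    brauerSubgroup {quatClass a b, quatClass a c} =
      Set.range fun i : Fin 4 => quatClass a (![1, b, c, b * c] i) := by
  refine Set.Subset.antisymm (fun x hx => ?_) ?_
  · suffices h : ∃ m n : ℕ, x = quatClass a (b ^ m * c ^ n) by
      obtain ⟨m, n, rfl⟩ := h
      exact quatClass_pow_mul_pow_mem a b c m n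
    induction hx with
    | of_mem hx =>
      rcases hx with rfl | rfl
      · exact ⟨1, 0, by simp⟩
      · exact ⟨0, 1, by simp⟩
    | one A e => exact ⟨0, 0, by simpa using brauerClass_eq_quatClass_one e a⟩
    | mul _ _ h hx hy =>
      obtain ⟨m, n, rfl⟩ := hx
      obtain ⟨m', n', rfl⟩ := hy
      refine ⟨m + m', n + n', h.quatClass_eq.trans (congrArg _ ?_)⟩
      rw [pow_add, pow_add, mul_mul_mul_comm]
    | inv A B _ e h =>
      obtain ⟨m, n, h⟩ := h
      exact ⟨m, n, brauerClass_eq_of_mulOpposite h e⟩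
  · have hb : quatClass a b ∈ brauerSubgroup {quatClass a b, quatClass a c} := .of_mem (.inl rfl)
    have hc : quatClass a c ∈ brauerSubgroup {quatClass a b, quatClass a c} := .of_mem (.inr rfl)
    rintro _ ⟨i, rfl⟩
    fin_cases i
    · let A : CSA.{u, u} F := CSA.mk (AlgCat.of F F)
      have h : A.brauerClass = quatClass a 1 := brauerClass_eq_quatClass_one AlgEquiv.refl a
      have h' := brauerSubgroup.one (S := {quatClass a b, quatClass a c}) A AlgEquiv.refl
      rwa [h] at h'
    · exact hb
    · exact hc
    · exact .mul hb hc (isBrauerProduct_quatClass a b c)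

/-- The group of the four classes is elementary abelian of exponent 2: if the classes of `[a, b)`,
`[a, c)` and `[a, b c)` are nontrivial, the four classes are distinct. -/
theorem quatClass_injective_of_ne {a : F} {b c : Fˣ} (hb : quatClass a b ≠ quatClass a 1)
    (hc : quatClass a c ≠ quatClass a 1) (hbc : quatClass a (b * c) ≠ quatClass a 1) :
    Function.Injective fun i : Fin 4 => quatClass a (![1, b, c, b * c] i) := by
  have key : ∀ x y z : Fˣ, quatClass a x ≠ quatClass a 1 → x * y = z →
      quatClass a y ≠ quatClass a z := by
    rintro x y _ hx rfl h
    refine hx ?_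
    have := quatClass_mul_congr h (rfl : quatClass a y = quatClass a y)
    rwa [← pow_two, mul_assoc, ← pow_two, quatClass_mul_sq, ← one_mul (y ^ 2), quatClass_mul_sq,
      eq_comm] at this
  have h1 := key b 1 b hb (mul_one b)
  have h2 := key c 1 c hc (mul_one c)
  have h3 := key _ 1 _ hbc (mul_one (b * c))
  have h4 := key c b (b * c) hc (mul_comm c b)
  have h5 := key b c (b * c) hb rfl
  have h6 : quatClass a b ≠ quatClass a c := by
    rw [← quatClass_mul_sq a c b]
    exact key (b * c) b (c * b ^ 2) hbc (by rw [pow_two, mul_comm b c, mul_assoc])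
  intro i j hij
  fin_cases i <;> fin_cases j <;>
    first
    | rfl
    | exact absurd hij ‹_›
    | exact absurd hij.symm ‹_›

/-- If the group of the four classes is neither of order 2 nor of order 4, it is trivial. -/
theorem quatClass_injective_or_eq_one {a : F} {b c : Fˣ}
    (h : (Set.range fun i : Fin 4 => quatClass a (![1, b, c, b * c] i)).ncard ≠ 2) :
    (Function.Injective fun i : Fin 4 => quatClass a (![1, b, c, b * c] i)) ∨
      ∀ i : Fin 4, quatClass a (![1, b, c, b * c] i) = quatClass a 1 := by
  have hr : (Set.range fun i : Fin 4 => quatClass a (![1, b, c, b * c] i)) =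
      {quatClass a 1, quatClass a b, quatClass a c, quatClass a (b * c)} := by
    ext x
    simp [Fin.exists_fin_succ, eq_comm]
  have hp : ∀ x : Fˣ, (Set.range fun i : Fin 4 => quatClass a (![1, b, c, b * c] i)) =
      {quatClass a 1, quatClass a x} → quatClass a x = quatClass a 1 := fun x hx => by
    by_contra hne
    exact h (by rw [hx, Set.ncard_pair (Ne.symm hne)])
  have hall : quatClass a b = quatClass a 1 → quatClass a c = quatClass a 1 →
      ∀ i : Fin 4, quatClass a (![1, b, c, b * c] i) = quatClass a 1 := fun hb hc i => by
    have hbc := quatClass_mul_congr hb hc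
    rw [mul_one] at hbc
    fin_cases i
    exacts [rfl, hb, hc, hbc]
  by_cases hb : quatClass a b = quatClass a 1
  · have hbc := quatClass_mul_congr hb (rfl : quatClass a c = quatClass a c)
    rw [one_mul] at hbc
    exact .inr (hall hb (hp c (by rw [hr, hb, hbc]; simp)))
  by_cases hc : quatClass a c = quatClass a 1
  · have hbc := quatClass_mul_congr (rfl : quatClass a b = quatClass a b) hc
    rw [mul_one] at hbc
    exact absurd (hp b (by rw [hr, hc, hbc]; ext x; simp)) hb
  by_cases hbc : quatClass a (b * c) = quatClass a 1
  · have h1 := quatClass_mul_congr hbc (rfl : quatClass a c = quatClass a c)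
    rw [one_mul, mul_assoc, ← pow_two, quatClass_mul_sq] at h1
    exact absurd (hp b (by rw [hr, hbc, ← h1]; ext x; simp [or_comm])) hb
  · exact .inl (quatClass_injective_of_ne hb hc hbc)

end Brauer

/-! ### Common separable quadratic extensions -/

section QuadraticExtension

variable {F : Type u} [Field F] [CharP F 2]

/-- The Artin–Schreier extension `F[ω]`, `ω² = d + ω`, is separable: a non-scalar element `z` is a
root of `X² + tr(z) X + N(z)`, whose derivative is the nonzero constant `tr(z)`. -/
theorem QuadraticAlgebra.isSeparableQuadratic (d : F) [Fact (∀ r : F, r ^ 2 ≠ d + 1 * r)] :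
    IsSeparableQuadratic F (QuadraticAlgebra F d 1) := by
  refine ⟨⟨fun z => ?_⟩, QuadraticAlgebra.finrank_eq_two d 1⟩
  by_cases hz : z.im = 0
  · have : z = algebraMap F _ z.re := by ext <;> simp [hz]
    rw [this]
    exact isSeparable_algebraMap _
  · let p : Polynomial F := .X ^ 2 - .C (trace z) * .X + .C (norm z)
    have hp : Polynomial.aeval z p = 0 := by
      have := sq_sub_trace_smul_add_norm_eq_zero (z := z)
      simpa [p, Algebra.smul_def] using this
    have hsep : p.Separable := by
      have hd : p.derivative = .C z.im := by
        have h2 : (2 : Polynomial F) = 0 := CharTwo.two_eq_zero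
        simp [p, trace_def, CharTwo.two_eq_zero]
        linear_combination (.X - .C z.im) * h2
      rw [Polynomial.separable_def, hd]
      have hu : IsUnit (Polynomial.C z.im) := Polynomial.isUnit_C.mpr (isUnit_iff_ne_zero.mpr hz)
      exact isCoprime_one_right.of_isCoprime_of_dvd_right hu.dvd
    exact hsep.of_dvd (minpoly.dvd F z hp)

/-- The quaternion algebras `[d, b)` share a separable quadratic extension: if `X² + X + d` is
irreducible, the field that it defines; otherwise the algebras are split and contain
every quadratic extension. -/
theorem exists_isSeparableQuadratic_algHom (d : F)
    (h : ∃ (K : Type u) (_ : Field K) (_ : Algebra F K), IsSeparableQuadratic F K) :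
    ∃ (K : Type u) (_ : Field K) (_ : Algebra F K), IsSeparableQuadratic F K ∧
      ∀ b : Fˣ, Nonempty (K →ₐ[F] Quat d b) := by
  by_cases ht : ∃ t : F, t ^ 2 + t = d
  · obtain ⟨t, rfl⟩ := ht
    obtain ⟨K, _, _, hK⟩ := h
    refine ⟨K, _, _, hK, fun b => ?_⟩
    obtain ⟨e⟩ := Quat.nonempty_algEquiv_matrix t b
    have : FiniteDimensional F K := .of_finrank_pos (by rw [hK.2]; norm_num)
    exact ⟨e.symm.toAlgHom.comp
      (Algebra.leftMulMatrix (Module.finBasisOfFinrankEq F K hK.2))⟩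
  · have : Fact (∀ r : F, r ^ 2 ≠ d + 1 * r) := ⟨fun r hr => ht ⟨r, by
      rw [hr, one_mul, add_assoc, CharTwo.add_self_eq_zero, add_zero]⟩⟩
    refine ⟨QuadraticAlgebra F d 1, inferInstance, inferInstance,
      QuadraticAlgebra.isSeparableQuadratic d, fun b => ⟨QuadraticAlgebra.lift
        ⟨(QuaternionAlgebra.Basis.self F).i, (QuaternionAlgebra.Basis.self F).i_mul_i⟩⟩⟩

end QuadraticExtension

/-! ### Sums of norm forms -/

section NormForms

variable {F : Type u} [Field F] [CharP F 2]

theorem normForm_equivalent_of_quatClass_eq {a a' : F} {b b' : Fˣ}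
    (h : quatClass a b = quatClass a' b') : (normForm a b).Equivalent (normForm a' b') :=
  let ⟨e⟩ := quatClass_eq_iff.mp h
  normForm_equivalent_of_algEquiv e

theorem isHyperbolic_normForm_one (a : F) : IsHyperbolic (normForm a 1) := by
  have h : IsHyperbolic ((binaryForm 1 a).prod (((1 : Fˣ) : F) • binaryForm 1 a)) := by
    simpa using isHyperbolic_smul_binaryForm_prod_self 1 a
  exact h.of_equivalent (normForm_equivalent_prod a 1)

theorem quadPfister_two_equivalent_normForm {a a' : F} {b : Fˣ}
    (h : quatClass a b = quatClass a' b) (c : Fˣ) :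
    (quadPfister ![c, b] a).Equivalent
      ((normForm a' b).prod ((c : F) • normForm a' b)) := by
  have h1 := (normForm_equivalent_prod a b).symm.trans (normForm_equivalent_of_quatClass_eq h)
  exact (quadPfister_two_equivalent c b a).trans (h1.prod (h1.smul _))

/-- The norm forms of `[a', c)`, `[a', b)` and `[a', c b)` add up to the Pfister form
`⟨⟨c, b, a']]`, which is isometric to `⟨⟨c, b, a]]` if `[a, b)` and `[a', b)` are isomorphic. -/
theorem wittEquivalent_normForm_sum {a a' : F} {b c : Fˣ}
    (h : quatClass a b = quatClass a' b) :
    WittEquivalent (((normForm a' c).prod (normForm a' b)).prod (normForm a' (c * b)))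
      (quadPfister ![c, b] a) := by
  have hd (x : Fˣ) := isHyperbolic_smul_binaryForm_prod_self x a'
  have h1 := hd 1
  rw [Units.val_one, one_smul] at h1
  have hN (x : Fˣ) := normForm_equivalent_prod a' x
  refine (wittEquivalent_sum_three h1 (hd c) (hd b) (hd (c * b))).of_equivalent
    (((hN c).prod (hN b)).prod (hN (c * b)))
    ((quadPfister_two_equivalent_normForm h c).trans ?_)
  have h2 := ((hN b).smul (c : F)).trans (.smul_prod _ _ _)
  rw [smul_smul, ← Units.val_mul] at h2
  exact (hN b).prod h2

/-- If the group has four elements, the trivial one contributes a hyperbolic norm form and the others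
add up to the Pfister form. If the group is trivial, all norm forms and the Pfister form are
hyperbolic. -/
theorem sigmaWittEquivalent_pair {a a' : F} {b c : Fˣ} (h : quatClass a b = quatClass a' b)
    (hG : (brauerSubgroup {quatClass a' c, quatClass a' b}).ncard ≠ 2) :
    SigmaWittEquivalent {quatClass a' c, quatClass a' b} (quadPfister ![c, b] a) := by
  unfold SigmaWittEquivalent IsTight
  rw [brauerSubgroup_pair_eq] at hG ⊢
  refine ⟨Set.finite_range _, ?_, fun m e r s hrs => ?_⟩
  · rintro _ ⟨i, rfl⟩
    exact ⟨_, _, rfl⟩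
  rcases quatClass_injective_or_eq_one hG with hinj | hone
  · let σ : Fin 4 ≃ Fin m := (Equiv.ofInjective _ hinj).trans e.symm
    have hσ : ∀ i, quatClass (r (σ i)) (s (σ i)) = quatClass a' (![1, c, b, c * b] i) := fun i => by
      rw [hrs]
      simp [σ]
    have h1 : (QuadraticMap.pi fun i => normForm (r i) (s i)).Equivalent
        ((normForm a' 1).prod
          (((normForm a' c).prod (normForm a' b)).prod (normForm a' (c * b)))) := by
      refine (QuadraticMap.Equivalent.piCongrLeft (fun i => normForm (r i) (s i)) σ).symm.trans ?_
      have h2 : ∀ i, (normForm (r (σ i)) (s (σ i))).Equivalent _ := fun i =>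
        (normForm_equivalent_of_quatClass_eq (hσ i)).trans (normForm_equivalent_prod _ _)
      refine (QuadraticMap.Equivalent.pi h2).trans ((equivalent_pi_fin_four _).trans ?_)
      have hN (x : Fˣ) := (normForm_equivalent_prod a' x).symm
      exact (hN 1).prod (((hN c).prod (hN b)).prod (hN (c * b)))
    have h3 : WittEquivalent ((normForm a' 1).prod
        (((normForm a' c).prod (normForm a' b)).prod (normForm a' (c * b))))
        (quadPfister ![c, b] a) :=
      ((isHyperbolic_normForm_one a').prod (wittEquivalent_normForm_sum h)).of_equivalent
        (.prodAssoc _ _ _)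
    exact h3.of_equivalent h1 (.refl _)
  · have hG1 : ∀ x : Set.range fun i : Fin 4 => quatClass a' (![1, c, b, c * b] i),
        (x : BrauerGroup F) = quatClass a' 1 := by
      rintro ⟨_, i, rfl⟩
      exact hone i
    let _ : Unique (Fin m) :=
      { default := e.symm ⟨_, 0, rfl⟩
        uniq := fun i => e.injective (Subtype.ext ((hG1 _).trans (hG1 _).symm)) }
    have h1 : IsHyperbolic (QuadraticMap.pi fun i => normForm (r i) (s i)) :=
      .pi_unique ((isHyperbolic_normForm_one a').of_equivalent
        (normForm_equivalent_of_quatClass_eq ((hrs default).trans (hG1 _))))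
    have h2 : IsHyperbolic (normForm a' b) := (isHyperbolic_normForm_one a').of_equivalent
      (normForm_equivalent_of_quatClass_eq (hone 2))
    exact h1.prod ((h2.prod (h2.smul c)).of_equivalent (quadPfister_two_equivalent_normForm h c))

end NormForms

theorem mainTheorem8 {F : Type u} [Field F] [CharP F 2] (α : F) (β γ : Fˣ)
    (h : (β : F) ≠ α ^ 2) (ψ φ : F × Fˣ)
    (hψ : ψ = (α ^ 2 + (β : F), γ))
    (hφ : φ = ((β : F) + α ^ 4 * (β : F)⁻¹, Units.mk0 ((β : F) + α ^ 2) (add_sq_ne_zero h))) :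
    -- the two quaternion algebras are separably linked, as norm forms and through subfields
    QuatSeparablyLinked ![ψ, φ] ∧
    ((∃ (K : Type u) (_ : Field K) (_ : Algebra F K), IsSeparableQuadratic F K) →
      ShareSeparableQuadratic ![ψ, φ]) ∧
    -- the pair is tight
    IsTight {quatClass ψ.1 ψ.2, quatClass φ.1 φ.2} ∧
    -- the product of the classes is represented by a quaternion algebra, and for each such
    -- representative the sum of the three norm forms is Witt equivalent to the 3-fold Pfister form
    (∃ (a : F) (b : Fˣ),
      IsBrauerProduct (quatClass ψ.1 ψ.2) (quatClass φ.1 φ.2) (quatClass a b)) ∧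
    (∀ (a : F) (b : Fˣ),
      IsBrauerProduct (quatClass ψ.1 ψ.2) (quatClass φ.1 φ.2) (quatClass a b) →
        WittEquivalent (((normForm ψ.1 ψ.2).prod (normForm φ.1 φ.2)).prod (normForm a b))
          (quadPfister ![γ, β] α)) ∧
    -- the invariant of the pair is the Witt class of the 3-fold Pfister form
    ((brauerSubgroup {quatClass ψ.1 ψ.2, quatClass φ.1 φ.2}).ncard ≠ 2 →
      SigmaWittEquivalent {quatClass ψ.1 ψ.2, quatClass φ.1 φ.2} (quadPfister ![γ, β] α)) := by
  have h2 : (2 : F) = 0 := CharTwo.two_eq_zero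
  obtain ⟨d, hd, hd'⟩ : ∃ d : Fˣ, d = Units.mk0 ((β : F) + α ^ 2) (add_sq_ne_zero h) ∧
    (d : F) = β + α ^ 2 := ⟨_, rfl, rfl⟩
  -- `φ = [d² / β, d)` is isomorphic to `[d, β)`, where `d = β + α²`
  have hφ₁ : (β : F) + α ^ 4 * (β : F)⁻¹ = (d : F) ^ 2 * (β : F)⁻¹ := by
    rw [hd']
    field_simp
    linear_combination (-(β : F) * α ^ 2) * h2
  rw [← hd, hφ₁] at hφ
  rw [add_comm, ← hd'] at hψ
  subst hψ hφ
  obtain ⟨e⟩ := Quat.nonempty_algEquiv_swap α β d hd'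
  have hc : quatClass ((d : F) ^ 2 * (β : F)⁻¹) d = quatClass (d : F) β :=
    (quatClass_eq_iff.mpr ⟨e⟩).symm
  have hα : quatClass α β = quatClass (d : F) β := by
    have h1 := quatClass_eq_iff.mpr (Quat.nonempty_algEquiv_add α α 1 β)
    rw [← h1, hd']
    congr 1
    linear_combination α * h2
  dsimp only
  rw [hc]
  refine ⟨⟨Fin.elim0, d, ![γ, β], fun i => ?_⟩, fun hK => ?_, ?_,
    ⟨d, γ * β, isBrauerProduct_quatClass _ _ _⟩, fun a b hab => ?_, sigmaWittEquivalent_pair hα⟩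
  · refine QuadraticMap.Equivalent.trans ?_ (diagTensor_quadPfister_zero_equivalent _ _ _).symm
    fin_cases i
    · exact normForm_equivalent_prod _ _
    · exact (normForm_equivalent_of_quatClass_eq hc).trans (normForm_equivalent_prod _ _)
  · obtain ⟨K, _, _, hK, hb⟩ := exists_isSeparableQuadratic_algHom (d : F) hK
    refine ⟨K, _, _, hK, fun i => ?_⟩
    fin_cases i
    · exact hb γ
    · exact (hb β).map e.toAlgHom.comp
  · intro x hx
    rw [brauerSubgroup_pair_eq] at hx
    obtain ⟨i, rfl⟩ := hx
    exact ⟨_, _, rfl⟩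
  · exact (wittEquivalent_normForm_sum hα).of_equivalent
      (((QuadraticMap.Equivalent.refl _).prod (normForm_equivalent_of_quatClass_eq hc)).prod
        (normForm_equivalent_of_quatClass_eq hab.quatClass_eq)) (.refl _)
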